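/- Theorem 3.6. Let $g:\mathbb{R}^m\to[-\infty,\infty]$ be a polyhedral function, i.e. $g$ is proper (nowhere $-\infty$, not identically $+\infty$) and its epigraph $\{(z,\alpha)\in\mathbb{R}^m\times\mathbb{R} : g(z)\le\alpha\}$ is a polyhedral convex set (the solution set of finitely many affine inequalities). Let $\partial g$ be the subdifferential of convex analysis, $\operatorname{gph}\partial g=\{(z,\lambda):\lambda\in\partial g(z)\}\subset\mathbb{R}^m\times\mathbb{R}^m$, and let $(\bar z,\bar\lambda)\in\operatorname{gph}\partial g$. Let $$K=\{w\in\mathbb{R}^m : \langle\bar\lambda,w\rangle=\mathrm{d}g(\bar z)(w)\},\qquad \mathrm{d}g(\bar z)(w)=\liminf_{t\searrow0,\ w'\to w}\frac{g(\bar z+tw')-g(\bar z)}{t},$$ be the critical cone of $g$ at $\bar z$ for $\bar\lambda$. Here $C^*=\{v:\langle v,w\rangle\le0\ \text{for all } w\in C\}$ denotes the polar of a set $C$. For a set $\Omega\subset\mathbb{R}^d$ and $x\in\Omega$, the tangent cone $T_\Omega(x)$ is the set of all $w$ for which there are $t_k\searrow0$ and $w_k\to w$ with $x+t_kw_k\in\Omega$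 for all $k$; the regular normal cone is $\widehat N_\Omega(x)=T_\Omega(x)^*$; and the limiting normal cone $N_\Omega(x)$ is the set of all $v$ for which there are $x_k\to x$ with $x_k\in\Omega$ and $v_k\to v$ with $v_k\in\widehat N_\Omega(x_k)$ for all $k$. A face of $K$ is a set of the form $K\cap\{w:\langle v,w\rangle=0\}$ with $v\in K^*$, and $F_1-F_2=\{x-y: x\in F_1,\ y\in F_2\}$. Then the following hold. (a) $\widehat N_{\operatorname{gph}\partial g}(\bar z,\bar\lambda)=K^*\times K$. (b) $N_{\operatorname{gph}\partial g}(\bar z,\bar\lambda)=\bigcup\,(F_1-F_2)^*\times(F_1-F_2)$, where the union is over all pairs of faces $F_1,F_2$ of $K$ with $F_2\subset F_1$. (c) $\bar\lambda$ belongs to the relative interior of $\partial g(\bar z)$ if and only if $N_{\operatorname{gph}\partial g}(\bar z,\bar\lambda)=\widehat N_{\operatorname{gph}\partial g}(\bar z,\bar\lambda)$. -/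

import Mathlib

open Filter Topology
open scoped Pointwise

namespace PolyhedralFunction

/-- A polyhedral convex set: the solution set of finitely many (possibly zero) affine
inequalities. -/
def IsPolyhedralConvexSet {X : Type*} [AddCommGroup X] [Module ℝ X] (C : Set X) : Prop :=
  ∃ (n : ℕ) (f : Fin n → (X →ₗ[ℝ] ℝ)) (b : Fin n → ℝ), C = {x | ∀ i, f i x ≤ b i}

/-- The epigraph, as a subset of `E × ℝ`, of an extended-real-valued function. -/
def epigraph {E : Type*} (g : E → EReal) : Set (E × ℝ) :=
  {p | g p.1 ≤ (p.2 : EReal)}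

/-- A proper extended-real-valued function: it never takes the value `-∞` and is not
identically `+∞`. -/
def IsProperFunction {E : Type*} (g : E → EReal) : Prop :=
  (∀ z, g z ≠ ⊥) ∧ ∃ z, g z ≠ ⊤

/-- A polyhedral function: a proper function whose epigraph is a polyhedral convex set. -/
def IsPolyhedralFunction {E : Type*} [AddCommGroup E] [Module ℝ E] (g : E → EReal) : Prop :=
  IsProperFunction g ∧ IsPolyhedralConvexSet (epigraph g)

section

variable {E : Type*} [NormedAddCommGroup E] [InnerProductSpace ℝ E]

/-- The polar `C* = {v | ⟨v, w⟩ ≤ 0 for all w ∈ C}`. -/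
def polar (C : Set E) : Set E :=
  {v | ∀ w ∈ C, inner ℝ v w ≤ 0}

/-- The (Bouligand) tangent cone to `Ω` at `x`: the outer limit of `(Ω - x) / t` as `t ↘ 0`. -/
def tangentCone (Ω : Set E) (x : E) : Set E :=
  {w | ∃ (t : ℕ → ℝ) (u : ℕ → E), (∀ k, 0 < t k) ∧ Tendsto t atTop (𝓝 0) ∧
    Tendsto u atTop (𝓝 w) ∧ ∀ k, x + t k • u k ∈ Ω}

/-- The regular (Fréchet) normal cone to `Ω` at a point `x ∈ Ω`. -/
def regularNormalCone (Ω : Set E) (x : E) : Set E :=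
  polar (tangentCone Ω x)

/-- The limiting (Mordukhovich) normal cone to `Ω` at `x`: limits of regular normals taken at
points of `Ω` that converge to `x`. -/
def limitingNormalCone (Ω : Set E) (x : E) : Set E :=
  {v | ∃ (y : ℕ → E) (u : ℕ → E), (∀ k, y k ∈ Ω) ∧ (∀ k, u k ∈ regularNormalCone Ω (y k)) ∧
    Tendsto y atTop (𝓝 x) ∧ Tendsto u atTop (𝓝 v)}

/-- The subdifferential of convex analysis, empty at points where `g` is not finite. -/
def subdifferential (g : E → EReal) (z : E) : Set E :=
  {v | g z ≠ ⊥ ∧ g z ≠ ⊤ ∧ ∀ y, g z + ((inner ℝ v (y - z) : ℝ) : EReal) ≤ g y}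

/-- The graph of the subgradient mapping `∂g`, as a subset of the product `E × E` with its
inner product `⟨(u, w), (z, v)⟩ = ⟨u, z⟩ + ⟨w, v⟩`. -/
def subdifferentialGraph (g : E → EReal) : Set (WithLp 2 (E × E)) :=
  {p | p.snd ∈ subdifferential g p.fst}

/-- The subderivative `dg(z)(w)`: the lower limit of `(g (z + t w') - g z) / t` as `t ↘ 0`
and `w' → w`. It is used only where `g z` is finite. -/
noncomputable def subderivative (g : E → EReal) (z w : E) : EReal :=
  liminf (fun p : ℝ × E => (g (z + p.1 • p.2) - g z) / (p.1 : EReal)) (𝓝[>] (0 : ℝ) ×ˢ 𝓝 w)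

/-- The critical cone of `g` at `z` for `v`. -/
def criticalCone (g : E → EReal) (z v : E) : Set E :=
  {w | ((inner ℝ v w : ℝ) : EReal) = subderivative g z w}

/-- The collection of closed faces `F = C ∩ [v]^⊥`, `v ∈ C*`, of a polyhedral convex cone `C`. -/
def faces (C : Set E) : Set (Set E) :=
  {F | ∃ v ∈ polar C, F = C ∩ {w | inner ℝ v w = 0}}

/-- The product set `A × B` inside the inner product space `E × E`. -/
def prodSet (A B : Set E) : Set (WithLp 2 (E × E)) :=
  {p | p.fst ∈ A ∧ p.snd ∈ B}

end

end PolyhedralFunction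

open PolyhedralFunction

/-! Near the reference point, `gph ∂g` is a translate of the graph `G` of the normal cone mapping of
the polyhedral cone `K`. To see this, subtract the linear part from `g`: subgradients become normals
`(μ, -1)` to a polyhedral set in `β ≥ 0`. Farkas' lemma with bounded multipliers shows that for
small `(w, μ)` only the constraints active at the origin count and that `β = 0`
(`exists_forall_norm_lt_normal_iff`). Both normal cones are local, so everything reduces to `G` at
`0`.

For (a), `G` is a closed cone, hence its own tangent cone at `0`, with polar `K* × K`. For (b), the
same reduction applied to `G` at `(w, μ)` replaces `K` by the critical cone there, which is `F₁ -
F₂` with `F₁ = K ∩ μ^⊥` and `F₂` the minimal face of `w`. All pairs of nested faces arise, there are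
finitely many, and scaling the point does not change the cone, so limits of regular normals give
exactly the union. For (c), the pair `F₁ = F₂ = K` shows that the two normal cones agree iff `K` is
a subspace, equivalently iff `K*` is one; and `∂g(z̄) - λ̄` coincides with `K*` near `0`. -/

namespace PolyhedralFunction

/-! ### Finitely generated cones and Farkas' lemma -/

section FiniteCone

variable {E : Type*} [NormedAddCommGroup E] [InnerProductSpace ℝ E] {ι : Type*} [Fintype ι]

/-- Conic Carathéodory theorem: a conic combination can be rewritten as one whose support
indexes linearly independent vectors. -/
theorem exists_conic_combination_independent (u : ι → E) (x : ι → ℝ) (hx : 0 ≤ x) :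
    ∃ y : ι → ℝ, 0 ≤ y ∧ ∑ i, y i • u i = ∑ i, x i • u i ∧
      ∀ c : ι → ℝ, (∀ i, y i = 0 → c i = 0) → ∑ i, c i • u i = 0 → c = 0 := by
  classical
  induction hn : (Finset.univ.filter fun i => x i ≠ 0).card using Nat.strong_induction_on
    generalizing x with
  | _ n ih =>
  by_cases hind : ∀ c : ι → ℝ, (∀ i, x i = 0 → c i = 0) → ∑ i, c i • u i = 0 → c = 0
  · exact ⟨x, hx, rfl, hind⟩
  push Not at hind
  obtain ⟨c, hcs, hc0, hcne⟩ := hind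
  obtain ⟨c, hcs, hc0, j, hj⟩ : ∃ c : ι → ℝ, (∀ i, x i = 0 → c i = 0) ∧
      ∑ i, c i • u i = 0 ∧ ∃ j, 0 < c j := by
    obtain ⟨j, hj⟩ := Function.ne_iff.mp hcne
    rcases lt_or_gt_of_ne hj with h | h
    · refine ⟨-c, fun i hi => by simp [hcs i hi], by simp [hc0], j, by simpa using h⟩
    · exact ⟨c, hcs, hc0, j, h⟩
  -- Ratio test: subtracting `x k / c k` times the dependence keeps all coefficients nonnegative and
  -- cancels the `k`-th, so the support shrinks.
  obtain ⟨k, hk, hmin⟩ := (Finset.univ.filter fun i => 0 < c i).exists_min_image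
    (fun i => x i / c i) ⟨j, by simp [hj]⟩
  simp only [Finset.mem_filter, Finset.mem_univ, true_and] at hk hmin
  have ht : 0 ≤ x k / c k := div_nonneg (hx k) hk.le
  have hy : 0 ≤ fun i => x i - x k / c k * c i := by
    intro i
    simp only [Pi.zero_apply, sub_nonneg]
    rcases lt_or_ge 0 (c i) with h | h
    · exact (le_div_iff₀ h).1 (hmin i h)
    · exact (mul_nonpos_of_nonneg_of_nonpos ht h).trans (hx i)
  have hlt : (Finset.univ.filter fun i => x i - x k / c k * c i ≠ 0).card < n := by
    rw [← hn]
    refine Finset.card_lt_card (Finset.ssubset_iff_of_subset ?_ |>.2 ⟨k, ?_, ?_⟩)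
    · intro i hi
      simp only [Finset.mem_filter, Finset.mem_univ, true_and] at hi ⊢
      intro h
      exact hi (by simp [h, hcs i h])
    · simp only [Finset.mem_filter, Finset.mem_univ, true_and]
      intro h
      exact hk.ne' (hcs k h)
    · simp [div_mul_cancel₀ _ hk.ne']
  obtain ⟨y, hy0, hys, hyi⟩ := ih _ hlt _ hy rfl
  refine ⟨y, hy0, hys.trans ?_, hyi⟩
  simp only [sub_smul, Finset.sum_sub_distrib, mul_smul, ← Finset.smul_sum, hc0, smul_zero,
    sub_zero]

theorem exists_sum_le_norm_of_independent (u : ι → E) (S : Set ι)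
    (hS : ∀ c : ι → ℝ, (∀ i, i ∉ S → c i = 0) → ∑ i, c i • u i = 0 → c = 0) :
    ∃ C : ℝ, 0 ≤ C ∧ ∀ c : ι → ℝ, (∀ i, i ∉ S → c i = 0) →
      ∑ i, c i ≤ C * ‖∑ i, c i • u i‖ := by
  let V : Submodule ℝ (ι → ℝ) :=
    { carrier := {c | ∀ i, i ∉ S → c i = 0}
      add_mem' := fun {a b} ha hb i hi => by simp [ha i hi, hb i hi]
      zero_mem' := fun i _ => rfl
      smul_mem' := fun t a ha i hi => by simp [ha i hi] }
  let T : V →ₗ[ℝ] E := (Fintype.linearCombination ℝ u).comp V.subtype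
  have hT : ∀ c : V, T c = ∑ i, (c : ι → ℝ) i • u i := fun c => by
    simp [T, Fintype.linearCombination_apply]
  have hker : LinearMap.ker T = ⊥ := by
    rw [LinearMap.ker_eq_bot']
    intro c hc
    exact Subtype.ext (hS c c.2 (by rw [← hT, hc]))
  obtain ⟨C, -, hC⟩ := T.exists_antilipschitzWith hker
  refine ⟨Fintype.card ι * C, by positivity, fun c hc => ?_⟩
  have h1 : ‖c‖ ≤ C * ‖∑ i, c i • u i‖ := by
    have := ZeroHomClass.bound_of_antilipschitz T hC ⟨c, hc⟩
    rwa [hT] at this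
  calc ∑ i, c i ≤ ∑ _i : ι, ‖c‖ :=
        Finset.sum_le_sum fun i _ => (le_abs_self _).trans (norm_le_pi_norm c i)
    _ = Fintype.card ι * ‖c‖ := by simp
    _ ≤ _ := by rw [mul_assoc]; gcongr

/-- The elements of a finitely generated cone have conic representations with coefficients
bounded by a multiple of the norm. -/
theorem exists_bound_conic_combination (u : ι → E) :
    ∃ C : ℝ, 0 ≤ C ∧ ∀ x : ι → ℝ, 0 ≤ x → ∃ y : ι → ℝ, 0 ≤ y ∧
      ∑ i, y i • u i = ∑ i, x i • u i ∧ ∑ i, y i ≤ C * ‖∑ i, x i • u i‖ := by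
  classical
  have h : ∀ S : Set ι, ∃ C : ℝ, 0 ≤ C ∧
      ((∀ c : ι → ℝ, (∀ i, i ∉ S → c i = 0) → ∑ i, c i • u i = 0 → c = 0) →
      ∀ c : ι → ℝ, (∀ i, i ∉ S → c i = 0) → ∑ i, c i ≤ C * ‖∑ i, c i • u i‖) := by
    intro S
    by_cases hS : ∀ c : ι → ℝ, (∀ i, i ∉ S → c i = 0) → ∑ i, c i • u i = 0 → c = 0
    · obtain ⟨C, h0, hC⟩ := exists_sum_le_norm_of_independent u S hS
      exact ⟨C, h0, fun _ => hC⟩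
    · exact ⟨0, le_rfl, fun h => absurd h hS⟩
  choose C hC0 hC using h
  -- There are only finitely many possible supports, so summing their constants gives a uniform one.
  refine ⟨∑ S, C S, Finset.sum_nonneg fun S _ => hC0 S, fun x hx => ?_⟩
  obtain ⟨y, hy0, hys, hyi⟩ := exists_conic_combination_independent u x hx
  refine ⟨y, hy0, hys, ?_⟩
  have := hC {i | y i ≠ 0} (fun c hc => hyi c fun i hi => hc i (by simpa using hi)) y
    (fun i hi => by simpa using hi)
  rw [hys] at this
  refine this.trans ?_
  gcongr
  exact Finset.single_le_sum (f := C) (fun S _ => hC0 S) (Finset.mem_univ _)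

/-- Bounded representations of a convergent sequence lie in a compact box, where a subsequence of
coefficients converges. -/
theorem isClosed_range_conic_combination (u : ι → E) :
    IsClosed {v : E | ∃ x : ι → ℝ, 0 ≤ x ∧ ∑ i, x i • u i = v} := by
  obtain ⟨C, hC0, hC⟩ := exists_bound_conic_combination u
  refine IsSeqClosed.isClosed fun v w hv hw => ?_
  obtain ⟨R, hR⟩ := (Metric.isBounded_range_of_tendsto v hw).exists_norm_le
  have : ∀ k, ∃ y : ι → ℝ, y ∈ Set.Icc (0 : ι → ℝ) (fun _ => C * R) ∧ ∑ i, y i • u i = v k := by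
    intro k
    obtain ⟨x, hx, hxv⟩ := hv k
    obtain ⟨y, hy, hyv, hyC⟩ := hC x hx
    refine ⟨y, ⟨hy, fun i => ?_⟩, hyv.trans hxv⟩
    calc y i ≤ ∑ j, y j := Finset.single_le_sum (f := y) (fun j _ => hy j) (Finset.mem_univ i)
      _ ≤ C * ‖∑ i, x i • u i‖ := hyC
      _ ≤ C * R := by rw [hxv]; gcongr; exact hR _ ⟨k, rfl⟩
  choose y hy hyv using this
  obtain ⟨z, hz, φ, hφ, hlim⟩ := isCompact_Icc.tendsto_subseq hy
  refine ⟨z, hz.1, tendsto_nhds_unique (f := fun k => ∑ i, y (φ k) i • u i) (l := atTop) ?_ ?_⟩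
  · exact tendsto_finsetSum _ fun i _ => ((tendsto_pi_nhds.1 hlim) i).smul_const _
  · simp only [hyv]
    exact hw.comp hφ.tendsto_atTop

/-- Farkas' lemma. -/
theorem exists_conic_combination_of_mem_polar [FiniteDimensional ℝ E] (u : ι → E) {v : E}
    (hv : v ∈ polar {w : E | ∀ i, inner ℝ (u i) w ≤ 0}) :
    ∃ x : ι → ℝ, 0 ≤ x ∧ ∑ i, x i • u i = v := by
  classical
  set M : Set E := {v : E | ∃ x : ι → ℝ, 0 ≤ x ∧ ∑ i, x i • u i = v} with hM
  have hconv : Convex ℝ M := by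
    rintro _ ⟨x, hx, rfl⟩ _ ⟨y, hy, rfl⟩ a b ha hb -
    refine ⟨a • x + b • y, add_nonneg (smul_nonneg ha hx) (smul_nonneg hb hy), ?_⟩
    simp [add_smul, mul_smul, Finset.sum_add_distrib, Finset.smul_sum]
  have hadd : ∀ a ∈ M, ∀ i, a + u i ∈ M := by
    rintro _ ⟨x, hx, rfl⟩ i
    refine ⟨x + Pi.single i 1, add_nonneg hx (by simp), ?_⟩
    simp [add_smul, Finset.sum_add_distrib, Pi.single_apply]
  have h0 : (0 : E) ∈ M := ⟨0, le_rfl, by simp⟩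
  -- The residual `v - p` of the projection onto `M` pairs nonpositively with each `u i`, as `p + u
  -- i ∈ M`; polarity of `v` then forces it to vanish.
  obtain ⟨p, hp, hpv⟩ := exists_norm_eq_iInf_of_complete_convex ⟨0, h0⟩
    (isClosed_range_conic_combination u).isComplete hconv v
  rw [norm_eq_iInf_iff_real_inner_le_zero hconv hp] at hpv
  have he : v - p ∈ {w : E | ∀ i, inner ℝ (u i) w ≤ 0} := fun i => by
    have := hpv _ (hadd p hp i)
    rwa [add_sub_cancel_left, real_inner_comm] at this
  have h1 := hv _ he
  have h2 : 0 ≤ inner ℝ (v - p) p := by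
    have := hpv 0 h0
    simpa using this
  have h3 : v - p = 0 := by
    have : inner ℝ (v - p) (v - p) = inner ℝ v (v - p) - inner ℝ (v - p) p := by
      rw [inner_sub_left v p (v - p), real_inner_comm p]
    exact inner_self_eq_zero.1 (le_antisymm (by linarith) (real_inner_self_nonneg (x := v - p)))
  rw [sub_eq_zero.1 h3]
  exact hp

/-- Farkas' lemma with bounded multipliers. -/
theorem exists_bound_conic_combination_of_mem_polar [FiniteDimensional ℝ E] (u : ι → E) :
    ∃ C : ℝ, 0 ≤ C ∧ ∀ v ∈ polar {w : E | ∀ i, inner ℝ (u i) w ≤ 0},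
      ∃ x : ι → ℝ, 0 ≤ x ∧ ∑ i, x i • u i = v ∧ ∑ i, x i ≤ C * ‖v‖ := by
  obtain ⟨C, hC0, hC⟩ := exists_bound_conic_combination u
  refine ⟨C, hC0, fun v hv => ?_⟩
  obtain ⟨x, hx, rfl⟩ := exists_conic_combination_of_mem_polar u hv
  obtain ⟨y, hy, hyx, hyC⟩ := hC x hx
  exact ⟨y, hy, hyx, hyC⟩

end FiniteCone

/-- A point satisfying finitely many inequalities can be moved a little towards another point
that satisfies those that hold with equality. -/
theorem exists_pos_forall_segment_le {ι : Type*} [Finite ι] {a b r : ι → ℝ}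
    (h : ∀ i, a i < r i ∨ (a i ≤ r i ∧ b i ≤ r i)) :
    ∃ t : ℝ, 0 < t ∧ t < 1 ∧ ∀ i, a i + t * (b i - a i) ≤ r i := by
  have key : ∀ᶠ t : ℝ in 𝓝[>] 0, ∀ i, a i + t * (b i - a i) ≤ r i := by
    rw [eventually_all]
    intro i
    rcases h i with hi | ⟨hi, hi'⟩
    · have : Tendsto (fun t : ℝ => a i + t * (b i - a i)) (𝓝 0) (𝓝 (a i + 0 * (b i - a i))) :=
        Continuous.tendsto (by fun_prop) 0
      simp only [zero_mul, add_zero] at this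
      exact ((this.mono_left nhdsWithin_le_nhds).eventually_lt_const hi).mono fun _ h => h.le
    · filter_upwards [Ioo_mem_nhdsGT one_pos] with t ht
      nlinarith [ht.1, ht.2, mul_nonneg ht.1.le (sub_nonneg.2 hi'),
        mul_nonneg (sub_nonneg.2 ht.2.le) (sub_nonneg.2 hi)]
  obtain ⟨t, ht, h0, h1⟩ := (key.and (Ioo_mem_nhdsGT one_pos)).exists
  exact ⟨t, h0, h1, ht⟩

end PolyhedralFunction

namespace PolyhedralFunction

/-! ### The local reduction to a normal cone mapping -/

section LocalGraph

variable {E : Type*} [NormedAddCommGroup E] [InnerProductSpace ℝ E]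

/-- The graph `{(w, μ) | w ∈ K, μ ∈ K*, ⟨μ, w⟩ = 0}` of the normal cone mapping of a
closed convex cone `K`. -/
def normalGraph (K : Set E) : Set (WithLp 2 (E × E)) :=
  {p | p.fst ∈ K ∧ p.snd ∈ polar K ∧ inner ℝ p.snd p.fst = 0}

variable {ι : Type*} [Fintype ι]

/-- Let `C = {(w, β) | ⟨uᵢ, w⟩ + sᵢ β ≤ rᵢ}` be a polyhedral set contained in `β ≥ 0` and
containing the origin. Then the pairs `(w, μ)` near the origin such that `(μ, -1)` is normal to
`C` at some `(w, β)` form the graph of the normal cone mapping of a polyhedral cone. -/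
theorem exists_forall_norm_lt_normal_iff [FiniteDimensional ℝ E] (u : ι → E) (s r : ι → ℝ)
    (hr : ∀ i, 0 ≤ r i)
    (hC : ∀ y γ, (∀ i, inner ℝ (u i) y + s i * γ ≤ r i) → 0 ≤ γ) :
    ∃ ε > 0, ∀ w μ : E, ‖w‖ < ε → ‖μ‖ < ε →
      ((∃ β : ℝ, (∀ i, inner ℝ (u i) w + s i * β ≤ r i) ∧
        ∀ y γ, (∀ i, inner ℝ (u i) y + s i * γ ≤ r i) → inner ℝ μ (y - w) ≤ γ - β) ↔
      WithLp.toLp 2 (w, μ) ∈ normalGraph {w : E | ∀ i, r i = 0 → inner ℝ (u i) w ≤ 0}) := by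
  classical
  set K : Set E := {w : E | ∀ i, r i = 0 → inner ℝ (u i) w ≤ 0} with hK
  obtain ⟨C, hC0, hCK⟩ := exists_bound_conic_combination_of_mem_polar
    (fun i : {i // r i = 0} => u i)
  have hKeq : {w : E | ∀ i : {i // r i = 0}, inner ℝ (u i) w ≤ 0} = K := by
    ext w; simp [hK]
  rw [hKeq] at hCK
  set M : ℝ := 1 + ∑ i, (‖u i‖ + |s i|) with hM
  have hM1 : 1 ≤ M := le_add_of_nonneg_right (Finset.sum_nonneg fun i _ => by positivity)
  have hMi : ∀ i, ‖u i‖ + |s i| < M := fun i => by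
    have := Finset.single_le_sum (f := fun i => ‖u i‖ + |s i|) (s := Finset.univ)
      (fun i _ => by positivity) (Finset.mem_univ i)
    linarith
  obtain ⟨ρ, hρ, hρr⟩ : ∃ ρ > 0, ∀ i, r i ≠ 0 → ρ ≤ r i := by
    have : ∀ᶠ ρ : ℝ in 𝓝[>] 0, ∀ i, r i ≠ 0 → ρ ≤ r i := by
      rw [eventually_all]
      intro i
      by_cases hi : r i = 0
      · simp [hi]
      · filter_upwards [Ioo_mem_nhdsGT (lt_of_le_of_ne (hr i) (Ne.symm hi))] with ρ hρ _
        exact hρ.2.le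
    obtain ⟨ρ, h, h0⟩ := (this.and self_mem_nhdsWithin).exists
    exact ⟨ρ, h0, h⟩
  -- The bound `1` gives `β ≤ ‖w‖`, `ρ / M` keeps inactive constraints strict at `(w, β)`, and `1 /
  -- (C * M + 1)` makes the factor `C * ‖μ‖ * M` of `hmul` less than `1`.
  have hε : 0 < min 1 (min (ρ / M) (1 / (C * M + 1))) := by
    have : 0 < C * M + 1 := by positivity
    positivity
  refine ⟨_, hε, fun w μ hw hμ => ?_⟩
  simp only [lt_min_iff] at hw hμ
  obtain ⟨hw1, hwρ, -⟩ := hw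
  obtain ⟨hμ1, -, hμC⟩ := hμ
  rw [lt_div_iff₀ (by positivity)] at hμC hwρ
  have hμS : C * ‖μ‖ * M ≤ ‖μ‖ * (C * M + 1) := by nlinarith [norm_nonneg μ]
  have hwM : ∀ i β, 0 ≤ β → β ≤ ‖w‖ → inner ℝ (u i) w + s i * β ≤ M * ‖w‖ := by
    intro i β h0 h1
    have h2 := real_inner_le_norm (u i) w
    have h3 : s i * β ≤ |s i| * ‖w‖ := by
      nlinarith [le_abs_self (s i), abs_nonneg (s i)]
    nlinarith [hMi i, norm_nonneg w]
  -- the multiplier estimate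
  have hmul : μ ∈ polar K → ∀ y γ, 0 ≤ γ → (∀ i, r i = 0 → inner ℝ (u i) y + s i * γ ≤ 0) →
      inner ℝ μ y ≤ γ * (C * ‖μ‖ * M) := by
    intro hμK y γ hγ hy
    obtain ⟨x, hx, hxμ, hxC⟩ := hCK μ hμK
    calc inner ℝ μ y = ∑ i : {i // r i = 0}, x i * inner ℝ (u i) y := by
          rw [← hxμ, sum_inner]
          simp [inner_smul_left]
      _ ≤ ∑ i : {i // r i = 0}, x i * (γ * M) := by
          refine Finset.sum_le_sum fun i _ => mul_le_mul_of_nonneg_left ?_ (hx i)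
          have h1 := hy i i.2
          have h2 : -s i ≤ M := by
            have := hMi i
            have := neg_le_abs (s i)
            have := norm_nonneg (u i)
            linarith
          nlinarith
      _ = γ * ((∑ i, x i) * M) := by rw [← Finset.sum_mul]; ring
      _ ≤ _ := by gcongr
  constructor
  · rintro ⟨β, hβC, hβ⟩
    have hβ0 : 0 ≤ β := hC w β hβC
    have hβ1 : β ≤ inner ℝ μ w := by
      have := hβ 0 0 (by simpa using hr)
      simp only [zero_sub, inner_neg_right] at this
      linarith
    have hβw : β ≤ ‖w‖ := by
      have := real_inner_le_norm μ w
      nlinarith [norm_nonneg w]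
    have hact : ∀ i, r i = 0 → inner ℝ (u i) w + s i * β ≤ 0 := fun i hi => hi ▸ hβC i
    -- Inactive constraints are slack at `(w, β)`, so a short step towards `(y, γ)` stays feasible
    -- and the inequality rescales.
    have hcone : ∀ y γ, (∀ i, r i = 0 → inner ℝ (u i) y + s i * γ ≤ 0) →
        inner ℝ μ (y - w) ≤ γ - β := by
      intro y γ hy
      obtain ⟨t, ht0, -, ht⟩ := exists_pos_forall_segment_le
        (a := fun i => inner ℝ (u i) w + s i * β) (b := fun i => inner ℝ (u i) y + s i * γ)
        (r := r) (fun i => by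
          by_cases hi : r i = 0
          · exact Or.inr (by rw [hi]; exact ⟨hact i hi, hy i hi⟩)
          · refine Or.inl ((hwM i β hβ0 hβw).trans_lt ?_)
            linarith [hρr i hi])
      have := hβ (w + t • (y - w)) (β + t * (γ - β)) (fun i => by
        refine le_trans (le_of_eq ?_) (ht i)
        simp only [inner_add_right, inner_smul_right, inner_sub_right]
        ring)
      rw [add_sub_cancel_left, inner_smul_right, add_sub_cancel_left] at this
      exact le_of_mul_le_mul_left this ht0
    have hμw : inner ℝ μ w = β := by
      have h2 := hcone ((2 : ℝ) • w) (2 * β) (fun i hi => by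
        rw [inner_smul_right]; linarith [hact i hi])
      rw [two_smul, add_sub_cancel_right] at h2
      linarith
    have hμK : μ ∈ polar K := by
      intro y hy
      have := hcone y 0 (fun i hi => by simpa using hy i hi)
      rw [inner_sub_right] at this
      linarith
    -- The estimate reads `β ≤ θ β` with `θ < 1`.
    have hβz : β = 0 := by
      have := hmul hμK w β hβ0 hact
      rw [hμw] at this
      by_contra hne
      have hpos : 0 < β := lt_of_le_of_ne hβ0 (Ne.symm hne)
      nlinarith
    subst hβz
    exact ⟨fun i hi => by simpa using hact i hi, hμK, hμw⟩
  · rintro ⟨hwK, hμK, hμw⟩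
    change w ∈ K at hwK
    change μ ∈ polar K at hμK
    change inner ℝ μ w = 0 at hμw
    refine ⟨0, fun i => ?_, fun y γ hy => ?_⟩
    · by_cases hi : r i = 0
      · simpa [hi] using hwK i hi
      · have := hwM i 0 le_rfl (norm_nonneg w)
        have := hρr i hi
        linarith
    · have hγ := hC y γ hy
      have := hmul hμK y γ hγ (fun i hi => hi ▸ hy i)
      rw [inner_sub_right, hμw]
      nlinarith

end LocalGraph

end PolyhedralFunction

namespace PolyhedralFunction

/-! ### Locality of tangent and normal cones -/

section Local

variable {F : Type*} [NormedAddCommGroup F] [InnerProductSpace ℝ F]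

theorem tangentCone_subset_of_eventually {Ω Ω' : Set F} {x x' : F}
    (h : ∀ᶠ d in 𝓝 (0 : F), x + d ∈ Ω → x' + d ∈ Ω') : tangentCone Ω x ⊆ tangentCone Ω' x' := by
  rintro w ⟨t, u, ht0, ht, hu, hΩ⟩
  have hlim : Tendsto (fun k => t k • u k) atTop (𝓝 0) := by simpa using ht.smul hu
  obtain ⟨N, hN⟩ := eventually_atTop.1 (hlim.eventually h)
  exact ⟨fun k => t (k + N), fun k => u (k + N), fun k => ht0 _,
    ht.comp (tendsto_add_atTop_nat N), hu.comp (tendsto_add_atTop_nat N),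
    fun k => hN _ (Nat.le_add_left _ _) (hΩ _)⟩

theorem regularNormalCone_eq_of_eventually {Ω Ω' : Set F} {x x' : F}
    (h : ∀ᶠ d in 𝓝 (0 : F), x + d ∈ Ω ↔ x' + d ∈ Ω') :
    regularNormalCone Ω x = regularNormalCone Ω' x' := by
  rw [regularNormalCone, regularNormalCone,
    (tangentCone_subset_of_eventually (h.mono fun _ => Iff.mp)).antisymm
      (tangentCone_subset_of_eventually (h.mono fun _ => Iff.mpr))]

/-- The two sets also agree, up to the same translation, around every point close enough to the base
point, so regular normals along the sequence carry over. -/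
theorem limitingNormalCone_subset_of_eventually {Ω Ω' : Set F} {x x' : F}
    (h : ∀ᶠ d in 𝓝 (0 : F), x + d ∈ Ω ↔ x' + d ∈ Ω') :
    limitingNormalCone Ω x ⊆ limitingNormalCone Ω' x' := by
  rintro v ⟨y, u, hy, hu, hyx, huv⟩
  have hlim : Tendsto (fun k => y k - x) atTop (𝓝 0) := by
    simpa using hyx.sub_const x
  obtain ⟨N, hN⟩ := eventually_atTop.1 (hlim.eventually h.eventually_nhds)
  refine ⟨fun k => x' + (y (k + N) - x), fun k => u (k + N), fun k => ?_, fun k => ?_, ?_,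
    huv.comp (tendsto_add_atTop_nat N)⟩
  · refine (hN (k + N) (Nat.le_add_left _ _)).self_of_nhds.1 ?_
    simpa using hy (k + N)
  · rw [← regularNormalCone_eq_of_eventually (Ω := Ω) (x := y (k + N))]
    · exact hu _
    · have h1 := hN (k + N) (Nat.le_add_left _ _)
      have h2 : Tendsto (fun d : F => y (k + N) - x + d) (𝓝 0) (𝓝 (y (k + N) - x)) := by
        simpa using (tendsto_id (x := 𝓝 (0 : F))).const_add (y (k + N) - x)
      filter_upwards [h2.eventually h1] with d hd
      rwa [← add_assoc, ← add_assoc, add_sub_cancel] at hd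
  · have := (hlim.comp (tendsto_add_atTop_nat N)).const_add x'
    simpa using this

theorem limitingNormalCone_eq_of_eventually {Ω Ω' : Set F} {x x' : F}
    (h : ∀ᶠ d in 𝓝 (0 : F), x + d ∈ Ω ↔ x' + d ∈ Ω') :
    limitingNormalCone Ω x = limitingNormalCone Ω' x' :=
  (limitingNormalCone_subset_of_eventually h).antisymm
    (limitingNormalCone_subset_of_eventually (h.mono fun _ => Iff.symm))

theorem tangentCone_zero_of_isClosed {G : Set F} (hG : IsClosed G)
    (hcone : ∀ t : ℝ, 0 < t → ∀ p ∈ G, t • p ∈ G) : tangentCone G 0 = G := by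
  ext w
  constructor
  · rintro ⟨t, u, ht0, -, hu, hΩ⟩
    refine hG.mem_of_tendsto hu (Eventually.of_forall fun k => ?_)
    have := hcone (t k)⁻¹ (inv_pos.2 (ht0 k)) _ (hΩ k)
    rwa [zero_add, inv_smul_smul₀ (ht0 k).ne'] at this
  · intro hw
    refine ⟨fun k => 1 / ((k : ℝ) + 1), fun _ => w, fun k => by positivity,
      tendsto_one_div_add_atTop_nhds_zero_nat, tendsto_const_nhds, fun k => ?_⟩
    rw [zero_add]
    exact hcone _ (by positivity) _ hw

end Local

/-! ### Polars and normals to the graph at the origin -/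

section Polar

variable {E : Type*} [NormedAddCommGroup E] [InnerProductSpace ℝ E]

theorem isClosed_polar (C : Set E) : IsClosed (polar C) := by
  have : polar C = ⋂ w ∈ C, {v | inner ℝ v w ≤ 0} := by ext; simp [polar]
  rw [this]
  exact isClosed_biInter fun w _ => isClosed_le (by fun_prop) continuous_const

theorem zero_mem_polar (C : Set E) : (0 : E) ∈ polar C := fun w _ => by simp

theorem smul_mem_polar {C : Set E} {v : E} (hv : v ∈ polar C) {t : ℝ} (ht : 0 ≤ t) :
    t • v ∈ polar C := fun w hw => by
  rw [inner_smul_left]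
  exact mul_nonpos_of_nonneg_of_nonpos ht (hv w hw)

theorem add_mem_polar {C : Set E} {v v' : E} (hv : v ∈ polar C) (hv' : v' ∈ polar C) :
    v + v' ∈ polar C := fun w hw => by
  rw [inner_add_left]
  exact add_nonpos (hv w hw) (hv' w hw)

/-- Serves as the bipolar theorem: cones already written as polars need no separation argument. -/
theorem polar_polar_polar (C : Set E) : polar (polar (polar C)) = polar C := by
  ext v
  constructor
  · exact fun hv w hw => hv w fun v' hv' => by rw [real_inner_comm]; exact hv' w hw
  · exact fun hv w hw => by rw [real_inner_comm]; exact hw v hv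

theorem setOf_forall_inner_nonpos_eq_polar {ι : Type*} (u : ι → E) :
    {w : E | ∀ i, inner ℝ (u i) w ≤ 0} = polar (Set.range u) := by
  ext w
  simp [polar, real_inner_comm]

theorem isClosed_normalGraph (S : Set E) : IsClosed (normalGraph (polar S)) := by
  have h1 : Continuous fun p : WithLp 2 (E × E) => p.fst := by fun_prop
  have h2 : Continuous fun p : WithLp 2 (E × E) => p.snd := by fun_prop
  exact ((isClosed_polar S).preimage h1).inter
    (((isClosed_polar (polar S)).preimage h2).inter (isClosed_eq (h2.inner h1) continuous_const))

theorem smul_mem_normalGraph {S : Set E} {p : WithLp 2 (E × E)} (hp : p ∈ normalGraph (polar S))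
    {t : ℝ} (ht : 0 ≤ t) : t • p ∈ normalGraph (polar S) := by
  obtain ⟨h1, h2, h3⟩ := hp
  refine ⟨smul_mem_polar h1 ht, smul_mem_polar h2 ht, ?_⟩
  simp [inner_smul_left, inner_smul_right, h3]

theorem regularNormalCone_normalGraph_zero (S : Set E) :
    regularNormalCone (normalGraph (polar S)) 0 = prodSet (polar (polar S)) (polar S) := by
  rw [regularNormalCone, tangentCone_zero_of_isClosed (isClosed_normalGraph S)
    fun t ht p hp => smul_mem_normalGraph hp ht.le]
  ext q
  constructor
  · intro hq
    refine ⟨fun w hw => ?_, ?_⟩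
    · have := hq (WithLp.toLp 2 (w, 0)) ⟨hw, zero_mem_polar _, by simp⟩
      simpa [WithLp.prod_inner_apply] using this
    · rw [← polar_polar_polar]
      intro μ hμ
      have := hq (WithLp.toLp 2 (0, μ)) ⟨zero_mem_polar _, hμ, by simp⟩
      simpa [WithLp.prod_inner_apply] using this
  · rintro ⟨h1, h2⟩ p ⟨hp1, hp2, -⟩
    rw [WithLp.prod_inner_apply]
    refine add_nonpos (h1 _ hp1) ?_
    change inner ℝ q.snd p.snd ≤ 0
    rw [real_inner_comm]
    exact hp2 _ h2

/-- Regular normals at a point where a set locally is the graph of the normal cone mapping of a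
closed convex cone. -/
theorem regularNormalCone_eq_prodSet_of_eventually {Ω : Set (WithLp 2 (E × E))}
    {p : WithLp 2 (E × E)} {S : Set E}
    (h : ∀ᶠ d in 𝓝 (0 : WithLp 2 (E × E)), p + d ∈ Ω ↔ d ∈ normalGraph (polar S)) :
    regularNormalCone Ω p = prodSet (polar (polar S)) (polar S) := by
  rw [← regularNormalCone_normalGraph_zero]
  exact regularNormalCone_eq_of_eventually (by simpa using h)

omit [InnerProductSpace ℝ E] in
theorem isClosed_prodSet {A B : Set E} (hA : IsClosed A) (hB : IsClosed B) :
    IsClosed (prodSet A B) := by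
  have h1 : Continuous fun p : WithLp 2 (E × E) => p.fst := by fun_prop
  have h2 : Continuous fun p : WithLp 2 (E × E) => p.snd := by fun_prop
  exact (hA.preimage h1).inter (hB.preimage h2)

omit [InnerProductSpace ℝ E] in
theorem eventually_norm_fst_snd_lt {ε : ℝ} (hε : 0 < ε) :
    ∀ᶠ d in 𝓝 (0 : WithLp 2 (E × E)), ‖d.fst‖ < ε ∧ ‖d.snd‖ < ε := by
  have h1 : Continuous fun p : WithLp 2 (E × E) => ‖p.fst‖ := by fun_prop
  have h2 : Continuous fun p : WithLp 2 (E × E) => ‖p.snd‖ := by fun_prop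
  have h1' := h1.tendsto 0
  have h2' := h2.tendsto 0
  simp only [WithLp.zero_fst, WithLp.zero_snd, norm_zero] at h1' h2'
  exact (h1'.eventually_lt_const hε).and (h2'.eventually_lt_const hε)

end Polar

/-! ### Faces and critical cones of a polyhedral cone -/

section PolyhedralCone

variable {E : Type*} [NormedAddCommGroup E] [InnerProductSpace ℝ E] {ι : Type*} (u : ι → E)

/-- The critical cone at `w`, for the normal vector `μ`, of the polyhedral cone
`{y | ⟨uᵢ, y⟩ ≤ 0 for all i}`. -/
def coneCriticalCone (p : WithLp 2 (E × E)) : Set E :=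
  {y | (∀ i, inner ℝ (u i) p.fst = 0 → inner ℝ (u i) y ≤ 0) ∧ inner ℝ p.snd y = 0}

/-- The face of a polyhedral cone that contains `w` in its relative interior. -/
def minimalFace (w : E) : Set E :=
  {y | (∀ i, inner ℝ (u i) y ≤ 0) ∧ ∀ i, inner ℝ (u i) w = 0 → inner ℝ (u i) y = 0}

variable {u} {K : Set E} (hK : K = {w : E | ∀ i, inner ℝ (u i) w ≤ 0})
include hK

theorem inner_nonpos_of_mem_normalGraph [Finite ι] {p : WithLp 2 (E × E)}
    (hp : p ∈ normalGraph K) {y : E} (hy : ∀ i, inner ℝ (u i) p.fst = 0 → inner ℝ (u i) y ≤ 0) :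
    inner ℝ p.snd y ≤ 0 := by
  subst hK
  obtain ⟨h1, h2, h3⟩ := hp
  obtain ⟨t, ht0, -, ht⟩ := exists_pos_forall_segment_le (a := fun i => inner ℝ (u i) p.fst)
    (b := fun i => inner ℝ (u i) (p.fst + y)) (r := fun _ => 0) (fun i => by
      rcases (h1 i).lt_or_eq with h | h
      · exact Or.inl h
      · exact Or.inr ⟨h.le, by rw [inner_add_right, h, zero_add]; exact hy i h⟩)
  have := h2 (p.fst + t • y) (fun i => by
    have := ht i
    simpa [inner_add_right, inner_smul_right] using this)
  rw [inner_add_right, h3, zero_add, inner_smul_right] at this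
  exact nonpos_of_mul_nonpos_right this ht0

/-- Since `⟨μ, y⟩ ≤ 0` is automatic, the equality constraint can be relaxed to `≥ 0`, so the active
`u i` and `-μ` suffice. -/
theorem coneCriticalCone_eq_polar [Finite ι] {p : WithLp 2 (E × E)} (hp : p ∈ normalGraph K) :
    ∃ S : Set E, coneCriticalCone u p = polar S := by
  refine ⟨{v | (∃ i, inner ℝ (u i) p.fst = 0 ∧ v = u i) ∨ v = -p.snd}, ?_⟩
  ext y
  constructor
  · rintro ⟨h1, h2⟩ v (⟨i, hi, rfl⟩ | rfl)
    · rw [real_inner_comm]; exact h1 i hi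
    · rw [inner_neg_right, real_inner_comm, h2, neg_zero]
  · intro hy
    have h1 : ∀ i, inner ℝ (u i) p.fst = 0 → inner ℝ (u i) y ≤ 0 := fun i hi => by
      rw [real_inner_comm]; exact hy _ (Or.inl ⟨i, hi, rfl⟩)
    have h2 := hy _ (Or.inr rfl)
    rw [inner_neg_right, real_inner_comm] at h2
    exact ⟨h1, le_antisymm (inner_nonpos_of_mem_normalGraph hK hp h1) (by linarith)⟩

/-- Near each of its points the graph of the normal cone mapping of a polyhedral cone is the
graph of the normal cone mapping of the critical cone (the reduction lemma). -/
theorem eventually_add_mem_normalGraph_iff [Fintype ι] [FiniteDimensional ℝ E]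
    {p : WithLp 2 (E × E)} (hp : p ∈ normalGraph K) :
    ∀ᶠ d in 𝓝 (0 : WithLp 2 (E × E)),
      p + d ∈ normalGraph K ↔ d ∈ normalGraph (coneCriticalCone u p) := by
  obtain ⟨h1, h2, h3⟩ := id hp
  have hmem : ∀ y, y ∈ K ↔ ∀ i, inner ℝ (u i) y ≤ 0 := fun y => by rw [hK]; rfl
  -- The constraint `none` reads `γ ≥ -⟨p.snd, y⟩`. With the others it describes the epigraph of
  -- `-⟨p.snd, ·⟩` restricted to `K - p.fst`.
  obtain ⟨ε, hε, h⟩ := exists_forall_norm_lt_normal_iff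
    (fun o : Option ι => o.elim (-p.snd) u) (fun o => o.elim (-1) fun _ => 0)
    (fun o => o.elim 0 fun i => -inner ℝ (u i) p.fst)
    (fun o => by cases o <;> simp; exact (hmem _).1 h1 _)
    (fun y γ hy => by
      simp only [Option.forall, Option.elim, inner_neg_left, zero_mul, add_zero] at hy
      have h4 := h2 (p.fst + y) ((hmem _).2 fun i => by
        rw [inner_add_right]; linarith [hy.2 i])
      rw [inner_add_right, h3] at h4
      linarith [hy.1])
  filter_upwards [eventually_norm_fst_snd_lt hε] with d hd
  have hcone : {w : E | ∀ o : Option ι, (o.elim 0 fun i => -inner ℝ (u i) p.fst) = (0 : ℝ) →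
      inner ℝ (o.elim (-p.snd) u) w ≤ 0} = coneCriticalCone u p := by
    ext y
    simp only [Option.forall, Option.elim, inner_neg_left, neg_eq_zero, Set.mem_ofPred_eq,
      forall_const, coneCriticalCone]
    constructor
    · rintro ⟨h5, h6⟩
      exact ⟨h6, le_antisymm (inner_nonpos_of_mem_normalGraph hK hp h6) (by linarith)⟩
    · rintro ⟨h5, h6⟩
      exact ⟨by linarith, h5⟩
  have key := h d.fst d.snd hd.1 hd.2
  rw [hcone] at key
  refine Iff.trans ?_ key
  simp only [Option.forall, Option.elim, inner_neg_left, zero_mul, add_zero]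
  constructor
  · rintro ⟨h5, h6, h7⟩
    simp only [WithLp.add_fst, WithLp.add_snd] at h5 h6 h7
    refine ⟨-inner ℝ p.snd d.fst, ⟨by simp, fun i => ?_⟩, ?_⟩
    · have := (hmem _).1 h5 i
      rw [inner_add_right] at this
      linarith
    · rintro y γ ⟨hy, hyi⟩
      have h8 := h6 (p.fst + y) ((hmem _).2 fun i => by rw [inner_add_right]; linarith [hyi i])
      rw [inner_sub_right]
      simp only [inner_add_left, inner_add_right] at h7 h8
      linarith
  · rintro ⟨β, ⟨hβ, hi⟩, h5⟩
    have hmemd : p.fst + d.fst ∈ K := (hmem _).2 fun i => by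
      rw [inner_add_right]; linarith [hi i]
    have h6 : ∀ k ∈ K, inner ℝ (p.snd + d.snd) (k - (p.fst + d.fst)) ≤ 0 := fun k hk => by
      have h7 := h5 (k - p.fst) (-inner ℝ p.snd (k - p.fst)) ⟨by simp, fun i => by
        rw [inner_sub_right]; linarith [(hmem _).1 hk i]⟩
      simp only [inner_add_left, inner_add_right, inner_sub_right] at h7 ⊢
      linarith
    have h7 := h6 0 ((hmem _).2 fun i => by simp)
    have h8 := h6 ((2 : ℝ) • (p.fst + d.fst)) ((hmem _).2 fun i => by
      rw [inner_smul_right]; linarith [(hmem _).1 hmemd i])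
    rw [two_smul, add_sub_cancel_right] at h8
    rw [zero_sub, inner_neg_right] at h7
    have h9 : inner ℝ (p.snd + d.snd) (p.fst + d.fst) = 0 := by linarith
    refine ⟨hmemd, fun k hk => ?_, h9⟩
    have := h6 k hk
    rw [inner_sub_right, h9] at this
    simpa using this

/-- For small `t > 0` the point `w + t y` lies in `K`, hence `y = (y + t⁻¹ w) - t⁻¹ w` is the
required splitting. Conversely, `±b` are both feasible directions at `w` for `b` in the minimal
face, so `μ` annihilates `b`. -/
theorem coneCriticalCone_eq_sub [Finite ι] {p : WithLp 2 (E × E)} (hp : p ∈ normalGraph K) :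
    coneCriticalCone u p = (K ∩ {y | inner ℝ p.snd y = 0}) - minimalFace u p.fst := by
  have hpos := fun y => inner_nonpos_of_mem_normalGraph hK hp (y := y)
  subst hK
  obtain ⟨h1, h2, h3⟩ := hp
  ext y
  constructor
  · rintro ⟨hy, hy0⟩
    obtain ⟨t, ht0, -, ht⟩ := exists_pos_forall_segment_le (a := fun i => inner ℝ (u i) p.fst)
      (b := fun i => inner ℝ (u i) (p.fst + y)) (r := fun _ => 0) (fun i => by
        rcases (h1 i).lt_or_eq with h | h
        · exact Or.inl h
        · exact Or.inr ⟨h.le, by rw [inner_add_right, h, zero_add]; exact hy i h⟩)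
    refine ⟨y + t⁻¹ • p.fst, ⟨fun i => ?_, ?_⟩, t⁻¹ • p.fst, ⟨fun i => ?_, fun i hi => ?_⟩, by simp⟩
    · have := ht i
      have h4 : inner ℝ (u i) (y + t⁻¹ • p.fst) =
          t⁻¹ * (inner ℝ (u i) p.fst + t * (inner ℝ (u i) (p.fst + y) - inner ℝ (u i) p.fst)) := by
        simp only [inner_add_right, inner_smul_right]
        field_simp
        ring
      rw [h4]
      exact mul_nonpos_of_nonneg_of_nonpos (inv_pos.2 ht0).le this
    · simp [inner_add_right, inner_smul_right, h3, hy0]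
    · rw [inner_smul_right]
      exact mul_nonpos_of_nonneg_of_nonpos (inv_pos.2 ht0).le (h1 i)
    · rw [inner_smul_right, hi, mul_zero]
  · rintro ⟨a, ⟨ha, ha0⟩, b, ⟨-, hb0⟩, rfl⟩
    have hb1 := hpos b fun i hi => (hb0 i hi).le
    have hb2 := hpos (-b) fun i hi => by rw [inner_neg_right, hb0 i hi, neg_zero]
    rw [inner_neg_right] at hb2
    refine ⟨fun i hi => ?_, ?_⟩
    · simpa [inner_sub_right, hb0 i hi] using ha i
    · rw [inner_sub_right, ha0]
      linarith

theorem minimalFace_mem_faces [Fintype ι] (w : E) : minimalFace u w ∈ faces K := by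
  classical
  subst hK
  have hval : ∀ y, inner ℝ (∑ i with inner ℝ (u i) w = 0, u i) y =
      ∑ i with inner ℝ (u i) w = 0, inner ℝ (u i) y := fun y => sum_inner _ _ _
  refine ⟨∑ i with inner ℝ (u i) w = 0, u i, fun y hy => ?_, ?_⟩
  · rw [hval]
    exact Finset.sum_nonpos fun i _ => hy i
  · ext y
    simp only [minimalFace, Set.mem_inter_iff, Set.mem_ofPred_eq, hval]
    refine and_congr_right fun hy => ?_
    rw [Finset.sum_eq_zero_iff_of_nonpos fun i _ => hy i]
    simp

theorem exists_eq_minimalFace_of_mem_faces [Fintype ι] {F : Set E} (hF : F ∈ faces K) :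
    ∃ w ∈ F, F = minimalFace u w := by
  classical
  subst hK
  obtain ⟨v, hv, rfl⟩ := hF
  -- For each constraint choose a point of the face where it is strict, if one exists; the sum of
  -- these points is strict wherever possible, hence relatively interior.
  have : ∀ i, ∃ y, ((∀ j, inner ℝ (u j) y ≤ 0) ∧ inner ℝ v y = 0) ∧
      (inner ℝ (u i) y = 0 → ∀ z, (∀ j, inner ℝ (u j) z ≤ 0) → inner ℝ v z = 0 →
        inner ℝ (u i) z = 0) := by
    intro i
    by_cases h : ∀ z, (∀ j, inner ℝ (u j) z ≤ 0) → inner ℝ v z = 0 → inner ℝ (u i) z = 0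
    · exact ⟨0, by simp, fun _ => h⟩
    · push Not at h
      obtain ⟨z, hz, hz0, hne⟩ := h
      exact ⟨z, ⟨hz, hz0⟩, fun h0 => absurd h0 hne⟩
  choose y hy hyi using this
  have hwK : ∀ j, inner ℝ (u j) (∑ i, y i) ≤ 0 := fun j => by
    rw [inner_sum]
    exact Finset.sum_nonpos fun i _ => (hy i).1 j
  have hwv : inner ℝ v (∑ i, y i) = 0 := by
    rw [inner_sum]
    exact Finset.sum_eq_zero fun i _ => (hy i).2
  refine ⟨∑ i, y i, ⟨hwK, hwv⟩, ?_⟩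
  ext z
  constructor
  · rintro ⟨hz, hz0⟩
    refine ⟨hz, fun i hi => hyi i ?_ z hz hz0⟩
    rw [inner_sum, Finset.sum_eq_zero_iff_of_nonpos fun k _ => (hy k).1 i] at hi
    exact hi i (Finset.mem_univ _)
  · rintro ⟨hz, hz0⟩
    refine ⟨hz, le_antisymm (hv z hz) ?_⟩
    -- From a relatively interior point one can also move slightly away from `z` inside `K`, which
    -- gives the reverse sign of `⟨v, z⟩`.
    obtain ⟨t, ht0, -, ht⟩ := exists_pos_forall_segment_le
      (a := fun i => inner ℝ (u i) (∑ i, y i))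
      (b := fun i => inner ℝ (u i) (∑ i, y i - z)) (r := fun _ => 0) (fun i => by
        rcases (hwK i).lt_or_eq with h | h
        · exact Or.inl h
        · exact Or.inr ⟨h.le, by rw [inner_sub_right, h, hz0 i h, sub_zero]⟩)
    have := hv (∑ i, y i - t • z) (fun i => by
      have := ht i
      simp only [inner_sub_right, inner_smul_right] at this ⊢
      linarith)
    rw [inner_sub_right, hwv, inner_smul_right] at this
    exact nonneg_of_mul_nonneg_right (by linarith) ht0

theorem finite_faces [Fintype ι] : (faces K).Finite := by
  refine (Set.finite_range fun S : Set ι =>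
    {y : E | (∀ i, inner ℝ (u i) y ≤ 0) ∧ ∀ i ∈ S, inner ℝ (u i) y = 0}).subset ?_
  intro F hF
  obtain ⟨w, -, rfl⟩ := exists_eq_minimalFace_of_mem_faces hK hF
  exact ⟨{i | inner ℝ (u i) w = 0}, rfl⟩

/-- Pair a point `w` whose minimal face is `F₂` with a vector `v` exposing `F₁`; the inclusion makes
them orthogonal. -/
theorem exists_coneCriticalCone_eq_sub [Fintype ι] {F₁ F₂ : Set E} (h₁ : F₁ ∈ faces K)
    (h₂ : F₂ ∈ faces K) (h : F₂ ⊆ F₁) :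
    ∃ p ∈ normalGraph K, coneCriticalCone u p = F₁ - F₂ := by
  obtain ⟨w, hw, rfl⟩ := exists_eq_minimalFace_of_mem_faces hK h₂
  obtain ⟨v, hv, rfl⟩ := h₁
  have hp : WithLp.toLp 2 (w, v) ∈ normalGraph K := ⟨(h hw).1, hv, (h hw).2⟩
  exact ⟨_, hp, coneCriticalCone_eq_sub hK hp⟩

omit hK in
theorem coneCriticalCone_smul {t : ℝ} (ht : t ≠ 0) (p : WithLp 2 (E × E)) :
    coneCriticalCone u (t • p) = coneCriticalCone u p := by
  simp [coneCriticalCone, inner_smul_left, inner_smul_right, ht]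

theorem regularNormalCone_normalGraph [Fintype ι] [FiniteDimensional ℝ E]
    {p : WithLp 2 (E × E)} (hp : p ∈ normalGraph K) :
    regularNormalCone (normalGraph K) p =
      prodSet (polar (coneCriticalCone u p)) (coneCriticalCone u p) := by
  obtain ⟨S, hS⟩ := coneCriticalCone_eq_polar hK hp
  have := eventually_add_mem_normalGraph_iff hK hp
  rw [hS] at this ⊢
  exact regularNormalCone_eq_prodSet_of_eventually this

theorem limitingNormalCone_normalGraph_zero [Fintype ι] [FiniteDimensional ℝ E] :
    limitingNormalCone (normalGraph K) 0 =
      ⋃ (F₁ ∈ faces K) (F₂ ∈ faces K) (_ : F₂ ⊆ F₁), prodSet (polar (F₁ - F₂)) (F₁ - F₂) := by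
  apply Set.Subset.antisymm
  · rintro v ⟨y, x, hy, hx, -, hv⟩
    have hclosed : IsClosed (⋃ (F₁ ∈ faces K) (F₂ ∈ faces K) (_ : F₂ ⊆ F₁),
        prodSet (polar (F₁ - F₂)) (F₁ - F₂)) := by
      refine (finite_faces hK).isClosed_biUnion fun F₁ h₁ =>
        (finite_faces hK).isClosed_biUnion fun F₂ h₂ => isClosed_iUnion_of_finite fun h => ?_
      obtain ⟨p, hp, hpF⟩ := exists_coneCriticalCone_eq_sub hK h₁ h₂ h
      obtain ⟨S, hS⟩ := coneCriticalCone_eq_polar hK hp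
      rw [← hpF, hS]
      exact isClosed_prodSet (isClosed_polar _) (isClosed_polar _)
    refine hclosed.mem_of_tendsto hv (Eventually.of_forall fun k => ?_)
    have hk := hx k
    rw [regularNormalCone_normalGraph hK (hy k), coneCriticalCone_eq_sub hK (hy k)] at hk
    have hsub : minimalFace u (y k).fst ⊆ K ∩ {z | inner ℝ (y k).snd z = 0} := by
      rintro z ⟨hz, hz0⟩
      have hb1 := inner_nonpos_of_mem_normalGraph hK (hy k) fun i hi => (hz0 i hi).le
      have hb2 := inner_nonpos_of_mem_normalGraph hK (hy k) (y := -z) fun i hi => by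
        rw [inner_neg_right, hz0 i hi, neg_zero]
      rw [inner_neg_right] at hb2
      exact ⟨by rw [hK]; exact hz, le_antisymm hb1 (by linarith)⟩
    simp only [Set.mem_iUnion]
    exact ⟨_, ⟨_, (hy k).2.1, rfl⟩, _, minimalFace_mem_faces hK _, hsub, hk⟩
  · refine Set.iUnion₂_subset fun F₁ h₁ => Set.iUnion₂_subset fun F₂ h₂ =>
      Set.iUnion_subset fun h => ?_
    obtain ⟨p, hp, hpF⟩ := exists_coneCriticalCone_eq_sub hK h₁ h₂ h
    intro v hv
    -- Shrinking `p` towards `0` leaves its critical cone, and so the regular normals, unchanged.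
    have hmem : ∀ k : ℕ, (1 / ((k : ℝ) + 1)) • p ∈ normalGraph K := fun k => by
      rw [hK, setOf_forall_inner_nonpos_eq_polar] at hp ⊢
      exact smul_mem_normalGraph hp (by positivity)
    refine ⟨fun k => (1 / ((k : ℝ) + 1)) • p, fun _ => v, hmem, fun k => ?_, ?_,
      tendsto_const_nhds⟩
    · rw [regularNormalCone_normalGraph hK (hmem k), coneCriticalCone_smul (by positivity), hpF]
      exact hv
    · simpa using (tendsto_one_div_add_atTop_nhds_zero_nat (𝕜 := ℝ)).smul_const p

-- Taking both faces equal to the cone puts `{0} × (K - K)` into the union; if the cone is a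
-- subspace, it is its only face.
omit hK in
theorem iUnion_faces_eq_prodSet_iff (S : Set E) :
    (⋃ (F₁ ∈ faces (polar S)) (F₂ ∈ faces (polar S)) (_ : F₂ ⊆ F₁),
      prodSet (polar (F₁ - F₂)) (F₁ - F₂)) = prodSet (polar (polar S)) (polar S) ↔
    ∀ w ∈ polar S, -w ∈ polar S := by
  have hself : polar S ∈ faces (polar S) := ⟨0, zero_mem_polar _, by simp⟩
  constructor
  · intro h w hw
    have : WithLp.toLp 2 (0, -w) ∈ prodSet (polar (polar S)) (polar S) := by
      rw [← h]
      simp only [Set.mem_iUnion]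
      exact ⟨_, hself, _, hself, le_rfl, zero_mem_polar _, 0, zero_mem_polar _, w, hw, by simp⟩
    exact this.2
  · intro h
    have hface : ∀ F ∈ faces (polar S), F = polar S := by
      rintro F ⟨v, hv, rfl⟩
      refine Set.inter_eq_left.2 fun w hw => le_antisymm (hv w hw) ?_
      have := hv _ (h w hw)
      rw [inner_neg_right] at this
      linarith
    have hsub : polar S - polar S = polar S := by
      apply Set.Subset.antisymm
      · rintro _ ⟨a, ha, b, hb, rfl⟩
        simpa [sub_eq_add_neg] using add_mem_polar ha (h b hb)
      · exact fun a ha => ⟨a, ha, 0, zero_mem_polar _, by simp⟩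
    ext q
    simp only [Set.mem_iUnion]
    constructor
    · rintro ⟨F₁, h₁, F₂, h₂, -, hq⟩
      rwa [hface _ h₁, hface _ h₂, hsub] at hq
    · intro hq
      exact ⟨_, hself, _, hself, le_rfl, by rwa [hsub]⟩

end PolyhedralCone

end PolyhedralFunction

namespace PolyhedralFunction

/-! ### Relative interior of a locally conical set -/

section RelativeInterior

variable {E : Type*} [NormedAddCommGroup E] [InnerProductSpace ℝ E]

theorem neg_mem_polar {C : Set E} (hC : ∀ w ∈ C, -w ∈ C) : ∀ v ∈ polar C, -v ∈ polar C := by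
  intro v hv w hw
  have := hv _ (hC w hw)
  rwa [inner_neg_right, ← inner_neg_left] at this

theorem mem_intrinsicInterior_iff_neg_mem_polar {D C : Set E} {x : E}
    (hloc : ∀ᶠ d in 𝓝 (0 : E), x + d ∈ D ↔ d ∈ polar C) (hglob : ∀ v ∈ D, v - x ∈ polar C) :
    x ∈ intrinsicInterior ℝ D ↔ ∀ v ∈ polar C, -v ∈ polar C := by
  have hx : x ∈ D := by simpa using hloc.self_of_nhds.2 (zero_mem_polar C)
  have hxs := subset_affineSpan ℝ D hx
  rw [mem_intrinsicInterior]
  constructor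
  · rintro ⟨y, hy, rfl⟩ v hv
    obtain ⟨t, ht, ht0⟩ : ∃ t : ℝ, (y : E) + t • v ∈ D ∧ 0 < t := by
      have h1 : Tendsto (fun t : ℝ => t • v) (𝓝[>] 0) (𝓝 0) := by
        have : Tendsto (fun t : ℝ => t • v) (𝓝 0) (𝓝 ((0 : ℝ) • v)) :=
          Continuous.tendsto (by fun_prop) 0
        rw [zero_smul] at this
        exact this.mono_left nhdsWithin_le_nhds
      obtain ⟨t, h2, h3⟩ := ((h1.eventually hloc).and self_mem_nhdsWithin).exists
      exact ⟨t, h2.2 (smul_mem_polar hv (le_of_lt h3)), h3⟩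
    -- A relatively interior point allows the segment to be prolonged beyond it: for small `a < 0`,
    -- `q a` is in `D`, and `hglob` gives the direction `-v`.
    let q : ℝ → affineSpan ℝ D := fun a =>
      ⟨AffineMap.lineMap (y : E) (y + t • v) a,
        AffineMap.lineMap_mem a hxs (subset_affineSpan ℝ D ht)⟩
    have hq : Continuous q := Continuous.subtype_mk (by fun_prop) _
    have hq0 : q 0 = y := Subtype.ext (by simp [q])
    have h1 : ∀ᶠ a in 𝓝[<] (0 : ℝ), (q a : E) ∈ D := by
      have h2 := hq.tendsto 0
      rw [hq0] at h2
      exact (h2.mono_left nhdsWithin_le_nhds).eventually (mem_interior_iff_mem_nhds.1 hy)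
    obtain ⟨a, ha, ha0⟩ := (h1.and self_mem_nhdsWithin).exists
    have ha0 : a < 0 := ha0
    have h3 := hglob _ ha
    have h4 : (q a : E) - y = (-(a * t)) • (-v) := by
      simp [q, AffineMap.lineMap_apply, mul_smul]
    rw [h4] at h3
    have h5 : 0 < -(a * t) := by nlinarith
    have := smul_mem_polar h3 (inv_pos.2 h5).le
    rwa [inv_smul_smul₀ h5.ne'] at this
  · intro h
    let L : Submodule ℝ E :=
      { carrier := polar C
        add_mem' := add_mem_polar
        zero_mem' := zero_mem_polar C
        smul_mem' := fun t v hv => by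
          rcases le_total 0 t with ht | ht
          · exact smul_mem_polar hv ht
          · have := smul_mem_polar (h v hv) (neg_nonneg.2 ht)
            rwa [neg_smul_neg] at this }
    have hspan : affineSpan ℝ D ≤ AffineSubspace.mk' x L := affineSpan_le.2 fun v hv =>
      AffineSubspace.mem_mk'.2 (hglob v hv)
    refine ⟨⟨x, hxs⟩, mem_interior_iff_mem_nhds.2 ?_, rfl⟩
    have h1 : Tendsto (fun q : affineSpan ℝ D => (q : E) - x) (𝓝 ⟨x, hxs⟩) (𝓝 0) := by
      have : Continuous fun q : affineSpan ℝ D => (q : E) - x := by fun_prop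
      simpa using this.tendsto ⟨x, hxs⟩
    filter_upwards [h1.eventually hloc] with q hq
    rw [add_sub_cancel] at hq
    exact hq.2 (AffineSubspace.mem_mk'.1 (hspan q.2))

end RelativeInterior

/-! ### Subgradients and critical cone of a polyhedral function -/

section PolyhedralFunction

variable {E : Type*} [NormedAddCommGroup E] [InnerProductSpace ℝ E] {g : E → EReal}

theorem IsPolyhedralFunction.exists_forall_le_iff [FiniteDimensional ℝ E]
    (hg : IsPolyhedralFunction g) :
    ∃ (n : ℕ) (p : Fin n → E) (s b : Fin n → ℝ), ∀ (z : E) (α : ℝ),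
      g z ≤ α ↔ ∀ i, inner ℝ (p i) z + s i * α ≤ b i := by
  obtain ⟨-, n, f, b, hf⟩ := hg
  refine ⟨n, fun i => (InnerProductSpace.toDual ℝ E).symm
    ((f i).comp (LinearMap.inl ℝ E ℝ)).toContinuousLinearMap, fun i => f i (0, 1), b,
    fun z α => ?_⟩
  have h1 : g z ≤ α ↔ (z, α) ∈ epigraph g := Iff.rfl
  rw [h1, hf]
  refine forall_congr' fun i => ?_
  have h2 : f i (z, α) = f i (z, 0) + f i (0, 1) * α := by
    have : ((z, α) : E × ℝ) = (z, 0) + α • (0, 1) := by simp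
    rw [this, map_add, map_smul, smul_eq_mul, mul_comm]
  rw [h2, InnerProductSpace.toDual_symm_apply]
  simp

/-- Taking `y = z` forces `α = g z`; this expresses subgradients as normals `(v, -1)` to the
epigraph. -/
theorem mem_subdifferential_iff (hg : IsProperFunction g) {z v : E} :
    v ∈ subdifferential g z ↔
      ∃ α : ℝ, g z ≤ α ∧ ∀ (y : E) (γ : ℝ), g y ≤ γ → inner ℝ v (y - z) ≤ γ - α := by
  constructor
  · rintro ⟨h1, h2, h3⟩
    refine ⟨(g z).toReal, EReal.le_coe_toReal h2, fun y γ hy => ?_⟩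
    have h4 := (h3 y).trans hy
    rw [← EReal.coe_toReal h2 h1] at h4
    norm_cast at h4
    linarith
  · rintro ⟨α, hα, h⟩
    have h1 := hg.1 z
    have h2 : g z ≠ ⊤ := (hα.trans_lt (EReal.coe_lt_top α)).ne
    have h0 := h z _ (EReal.le_coe_toReal h2)
    rw [sub_self, inner_zero_right] at h0
    have hα' : (g z).toReal ≤ α := EReal.toReal_le_toReal hα h1 (EReal.coe_ne_top α)
    refine ⟨h1, h2, fun y => ?_⟩
    by_cases hy : g y = ⊤
    · rw [hy]; exact le_top
    · have h4 := h y _ (EReal.le_coe_toReal hy)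
      rw [← EReal.coe_toReal h2 h1, ← EReal.coe_toReal hy (hg.1 y)]
      norm_cast
      linarith

omit [NormedAddCommGroup E] [InnerProductSpace ℝ E] in
theorem coe_le_sub_div {y : E} {α t c : ℝ} (hy : g y ≠ ⊥) (ht : 0 < t)
    (h : ∀ γ : ℝ, g y ≤ γ → c * t ≤ γ - α) : (c : EReal) ≤ (g y - α) / (t : EReal) := by
  rw [EReal.le_div_iff_mul_le (by exact_mod_cast ht) (EReal.coe_ne_top t)]
  by_cases hy' : g y = ⊤
  · rw [hy', EReal.top_sub_coe]
    exact le_top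
  · have := h _ (EReal.le_coe_toReal hy')
    rw [← EReal.coe_toReal hy' hy]
    exact_mod_cast this

omit [NormedAddCommGroup E] [InnerProductSpace ℝ E] in
theorem sub_div_le_coe {y : E} {α t c : ℝ} (hy : g y ≠ ⊥) (ht : 0 < t)
    (h : g y ≤ ((α + c * t : ℝ) : EReal)) : (g y - α) / (t : EReal) ≤ c := by
  rw [EReal.div_le_iff_le_mul (by exact_mod_cast ht) (EReal.coe_ne_top t)]
  have hy' : g y ≠ ⊤ := (h.trans_lt (EReal.coe_lt_top _)).ne
  rw [← EReal.coe_toReal hy' hy] at h ⊢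
  norm_cast at h ⊢
  linarith

theorem inner_le_sub_div_of_mem_subdifferential {z v : E} (hv : v ∈ subdifferential g z)
    (hg : ∀ y, g y ≠ ⊥) {t : ℝ} (ht : 0 < t) (w : E) :
    ((inner ℝ v w : ℝ) : EReal) ≤ (g (z + t • w) - g z) / (t : EReal) := by
  obtain ⟨h1, h2, h3⟩ := hv
  have h4 := h3 (z + t • w)
  rw [← EReal.coe_toReal h2 h1] at h4 ⊢
  refine coe_le_sub_div (hg _) ht fun γ hγ => ?_
  have h5 := h4.trans hγ
  rw [add_sub_cancel_left, inner_smul_right] at h5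
  norm_cast at h5
  linarith

theorem coe_le_subderivative {z w : E} {φ : E → ℝ} (hφ : Continuous φ)
    (h : ∀ t : ℝ, 0 < t → ∀ w', ((φ w' : ℝ) : EReal) ≤ (g (z + t • w') - g z) / (t : EReal)) :
    ((φ w : ℝ) : EReal) ≤ subderivative g z w := by
  have hlim : Tendsto (fun p : ℝ × E => ((φ p.2 : ℝ) : EReal)) (𝓝[>] (0 : ℝ) ×ˢ 𝓝 w)
      (𝓝 ((φ w : ℝ) : EReal)) :=
    ((continuous_coe_real_ereal.comp hφ).tendsto w).comp tendsto_snd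
  rw [← hlim.liminf_eq]
  refine liminf_le_liminf ?_
  have : ∀ᶠ p : ℝ × E in 𝓝[>] (0 : ℝ) ×ˢ 𝓝 w, p.1 ∈ Set.Ioi (0 : ℝ) :=
    tendsto_fst.eventually self_mem_nhdsWithin
  exact this.mono fun p hp => h p.1 hp p.2

theorem subderivative_le_coe {z w : E} {c : ℝ}
    (h : ∀ᶠ t : ℝ in 𝓝[>] 0, (g (z + t • w) - g z) / (t : EReal) ≤ c) :
    subderivative g z w ≤ c := by
  refine liminf_le_of_frequently_le' ?_
  have hlim : Tendsto (fun t : ℝ => (t, w)) (𝓝[>] (0 : ℝ)) (𝓝[>] (0 : ℝ) ×ˢ 𝓝 w) :=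
    tendsto_id.prodMk tendsto_const_nhds
  exact hlim.frequently h.frequently

theorem inner_le_subderivative {z v : E} (hv : v ∈ subdifferential g z)
    (hg : ∀ y, g y ≠ ⊥) (w : E) : ((inner ℝ v w : ℝ) : EReal) ≤ subderivative g z w :=
  coe_le_subderivative (by fun_prop) fun _ ht w' =>
    inner_le_sub_div_of_mem_subdifferential hv hg ht w'

theorem sub_mem_polar_criticalCone {z v l : E} (hv : v ∈ subdifferential g z)
    (hg : ∀ y, g y ≠ ⊥) : v - l ∈ polar (criticalCone g z l) := by
  intro w hw
  have h := inner_le_subderivative hv hg w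
  rw [← show _ = _ from hw, EReal.coe_le_coe_iff] at h
  rw [inner_sub_left]
  linarith

/-- The critical cone of a polyhedral function is a polyhedral cone, and near the reference point
the graph of the subdifferential is a translate of the graph of the normal cone mapping of the
critical cone. -/
theorem IsPolyhedralFunction.exists_criticalCone_eq_and_eventually [FiniteDimensional ℝ E]
    (hg : IsPolyhedralFunction g) {z l : E} (hl : l ∈ subdifferential g z) :
    ∃ (ι : Type) (_ : Fintype ι) (u : ι → E),
      criticalCone g z l = {w | ∀ i, inner ℝ (u i) w ≤ 0} ∧
      ∀ᶠ d in 𝓝 (0 : WithLp 2 (E × E)),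
        WithLp.toLp 2 (z, l) + d ∈ subdifferentialGraph g ↔
          d ∈ normalGraph (criticalCone g z l) := by
  classical
  have hbot := hg.1.1
  obtain ⟨n, p, s, b, hp⟩ := hg.exists_forall_le_iff
  obtain ⟨a, ha⟩ : ∃ a : ℝ, g z = a := ⟨(g z).toReal, (EReal.coe_toReal hl.2.1 hl.1).symm⟩
  -- These are the epigraph constraints in the coordinates `(y, γ)` of the point `(z + y, a + ⟨l, y⟩
  -- + γ)`; the subgradient inequality becomes `γ ≥ 0`.
  set u : Fin n → E := fun i => p i + s i • l with hu
  set r : Fin n → ℝ := fun i => b i - inner ℝ (p i) z - s i * a with hr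
  have hepi : ∀ (y : E) (γ : ℝ), g (z + y) ≤ ((a + inner ℝ l y + γ : ℝ) : EReal) ↔
      ∀ i, inner ℝ (u i) y + s i * γ ≤ r i := fun y γ => by
    rw [hp]
    refine forall_congr' fun i => ?_
    simp only [hu, hr, inner_add_right, inner_add_left, real_inner_smul_left]
    constructor <;> intro h <;> linarith
  have hsub : ∀ (y : E) (γ : ℝ), g (z + y) ≤ ((a + inner ℝ l y + γ : ℝ) : EReal) → 0 ≤ γ := by
    intro y γ h
    have h1 := (hl.2.2 (z + y)).trans h
    rw [ha, add_sub_cancel_left] at h1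
    norm_cast at h1
    linarith
  have hr0 : ∀ i, 0 ≤ r i := fun i => by
    have := (hepi 0 0).1 (by simp [ha]) i
    simpa using this
  have hC : ∀ y γ, (∀ i, inner ℝ (u i) y + s i * γ ≤ r i) → 0 ≤ γ :=
    fun y γ h => hsub y γ ((hepi y γ).2 h)
  have hcrit : criticalCone g z l = {w | ∀ i, r i = 0 → inner ℝ (u i) w ≤ 0} := by
    ext w
    constructor
    · intro hw i hi
      -- An active constraint with `γ ≥ 0` gives `⟨u i, y⟩ ≤ |s i| γ`, so `g` exceeds its linear
      -- part by at least `⟨u i, y⟩ / (1 + |s i|)`; the `1` avoids a zero denominator.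
      have h1 : ((inner ℝ l w + inner ℝ (u i) w / (1 + |s i|) : ℝ) : EReal) ≤
          subderivative g z w := by
        refine coe_le_subderivative (φ := fun w => inner ℝ l w + inner ℝ (u i) w / (1 + |s i|))
          (by fun_prop) fun t ht w' => ?_
        rw [ha]
        refine coe_le_sub_div (hbot _) ht fun γ hγ => ?_
        have hγ' : g (z + t • w') ≤
            ((a + inner ℝ l (t • w') + (γ - a - inner ℝ l (t • w')) : ℝ) : EReal) := by
          convert hγ using 2
          ring
        have h2 := hsub _ _ hγ'
        have h3 := (hepi _ _).1 hγ' i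
        rw [hi] at h3
        simp only [inner_smul_right] at h2 h3
        have h4 : inner ℝ (u i) w' / (1 + |s i|) * t ≤ γ - a - t * inner ℝ l w' := by
          rw [div_mul_eq_mul_div, div_le_iff₀ (by positivity)]
          nlinarith [neg_le_abs (s i)]
        linarith
      rw [← show _ = _ from hw, EReal.coe_le_coe_iff] at h1
      have h2 : inner ℝ (u i) w / (1 + |s i|) ≤ 0 := by linarith
      have h3 : 0 < 1 + |s i| := by positivity
      simpa using (div_le_iff₀ h3).1 h2
    · intro hw
      refine le_antisymm (inner_le_subderivative hl hbot w) (subderivative_le_coe ?_)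
      have h1 : ∀ᶠ t : ℝ in 𝓝[>] 0, ∀ i, t * inner ℝ (u i) w ≤ r i := by
        rw [eventually_all]
        intro i
        rcases (hr0 i).eq_or_lt with hi | hi
        · filter_upwards [self_mem_nhdsWithin] with t ht
          rw [← hi]
          exact mul_nonpos_of_nonneg_of_nonpos (le_of_lt ht) (hw i hi.symm)
        · have : Tendsto (fun t : ℝ => t * inner ℝ (u i) w) (𝓝 0)
              (𝓝 (0 * inner ℝ (u i) w)) := Continuous.tendsto (by fun_prop) 0
          rw [zero_mul] at this
          exact ((this.mono_left nhdsWithin_le_nhds).eventually_lt_const hi).mono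
            fun _ h => h.le
      filter_upwards [h1, self_mem_nhdsWithin] with t ht ht0
      rw [ha]
      refine sub_div_le_coe (hbot _) ht0 ?_
      have := (hepi (t • w) 0).2 fun i => by simpa [inner_smul_right] using ht i
      convert this using 2
      rw [inner_smul_right]
      ring
  refine ⟨{i // r i = 0}, inferInstance, fun i => u i, by rw [hcrit]; ext w; simp, ?_⟩
  obtain ⟨ε, hε, h⟩ := exists_forall_norm_lt_normal_iff u s r hr0 hC
  filter_upwards [eventually_norm_fst_snd_lt hε] with d hd
  rw [hcrit]
  refine Iff.trans ?_ (h d.fst d.snd hd.1 hd.2)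
  change l + d.snd ∈ subdifferential g (z + d.fst) ↔ _
  rw [mem_subdifferential_iff hg.1]
  constructor
  · rintro ⟨α, hα, h1⟩
    refine ⟨α - a - inner ℝ l d.fst, (hepi _ _).1 (by convert hα using 2; ring),
      fun y γ hy => ?_⟩
    have := h1 _ _ ((hepi y γ).2 hy)
    simp only [add_sub_add_left_eq_sub, inner_add_left, inner_sub_right] at this ⊢
    linarith
  · rintro ⟨β, hβ, h1⟩
    refine ⟨_, (hepi _ _).2 hβ, fun y γ hy => ?_⟩
    have := h1 (y - z) (γ - a - inner ℝ l (y - z)) ((hepi _ _).1 (by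
      rw [add_sub_cancel]; convert hy using 2; ring))
    simp only [inner_add_left, inner_sub_right, inner_add_right] at this ⊢
    linarith

end PolyhedralFunction

end PolyhedralFunction

theorem theorem3p6 (m : ℕ) (g : EuclideanSpace ℝ (Fin m) → EReal)
    (hg : IsPolyhedralFunction g) (zbar lbar : EuclideanSpace ℝ (Fin m))
    (hzl : lbar ∈ subdifferential g zbar) :
    regularNormalCone (subdifferentialGraph g) (WithLp.toLp 2 (zbar, lbar)) =
        prodSet (polar (criticalCone g zbar lbar)) (criticalCone g zbar lbar) ∧
      limitingNormalCone (subdifferentialGraph g) (WithLp.toLp 2 (zbar, lbar)) =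
        (⋃ (F₁ ∈ faces (criticalCone g zbar lbar)) (F₂ ∈ faces (criticalCone g zbar lbar))
          (_ : F₂ ⊆ F₁), prodSet (polar (F₁ - F₂)) (F₁ - F₂)) ∧
      (lbar ∈ intrinsicInterior ℝ (subdifferential g zbar) ↔
        limitingNormalCone (subdifferentialGraph g) (WithLp.toLp 2 (zbar, lbar)) =
          regularNormalCone (subdifferentialGraph g) (WithLp.toLp 2 (zbar, lbar))) := by
  
  obtain ⟨ι, _, u, hK, hloc⟩ := hg.exists_criticalCone_eq_and_eventually hzl
  have hpolar := hK.trans (setOf_forall_inner_nonpos_eq_polar u)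
  have hreg : regularNormalCone (subdifferentialGraph g) (WithLp.toLp 2 (zbar, lbar)) =
      prodSet (polar (criticalCone g zbar lbar)) (criticalCone g zbar lbar) := by
    rw [hpolar] at hloc ⊢
    exact regularNormalCone_eq_prodSet_of_eventually hloc
  have hlim : limitingNormalCone (subdifferentialGraph g) (WithLp.toLp 2 (zbar, lbar)) =
      ⋃ (F₁ ∈ faces (criticalCone g zbar lbar)) (F₂ ∈ faces (criticalCone g zbar lbar))
        (_ : F₂ ⊆ F₁), prodSet (polar (F₁ - F₂)) (F₁ - F₂) := by
    rw [← limitingNormalCone_normalGraph_zero hK]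
    exact limitingNormalCone_eq_of_eventually (by simpa using hloc)
  refine ⟨hreg, hlim, ?_⟩
  -- This is the slice of the local description at zero first component.
  have hsub : ∀ᶠ d in 𝓝 (0 : EuclideanSpace ℝ (Fin m)),
      lbar + d ∈ subdifferential g zbar ↔ d ∈ polar (criticalCone g zbar lbar) := by
    have hcont : Continuous fun d : EuclideanSpace ℝ (Fin m) =>
        WithLp.toLp 2 ((0 : EuclideanSpace ℝ (Fin m)), d) := by fun_prop
    filter_upwards [(hcont.tendsto' 0 0 rfl).eventually hloc] with d hd
    have h0 : (0 : EuclideanSpace ℝ (Fin m)) ∈ criticalCone g zbar lbar := by simp [hK]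
    simpa [subdifferentialGraph, normalGraph, h0] using hd
  rw [hlim, hreg, mem_intrinsicInterior_iff_neg_mem_polar hsub
    fun v hv => sub_mem_polar_criticalCone hv hg.1.1, hpolar, iUnion_faces_eq_prodSet_iff]
  -- It remains that `K` is symmetric iff `K*` is; the forward direction goes through the bipolar.
  refine ⟨fun h => ?_, neg_mem_polar⟩
  rw [← polar_polar_polar]
  exact neg_mem_polar h
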